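/- \textbf{Conventions.} For a nonzero real Banach space $X$, $\mathcal{PCLSC}(X)$ is the set of proper, convex, lower semicontinuous functions $X\to\,]-\infty,\infty]$, $\operatorname{dom} f=\{f<\infty\}$, and $f^*(x^*)=\sup_{x\in X}[\langle x,x^*\rangle-f(x)]$ for $x^*\in X^*$. The dual of $E\times E^*$ is identified with $E^*\times E^{**}$ by $\langle (y,y^*),(x^*,x^{**})\rangle=\langle y,x^*\rangle+\langle y^*,x^{**}\rangle$. A function $f\in\mathcal{PCLSC}(E\times E^*)$ is \emph{strongly representative} on $E\times E^*$ if $f(x,x^*)\ge\langle x,x^*\rangle$ for all $(x,x^*)\in E\times E^*$ and $f^*(x^*,x^{**})\ge\langle x^*,x^{**}\rangle$ for all $(x^*,x^{**})\in E^*\times E^{**}$. Then $\mathcal M f$ is the multifunction $E\rightrightarrows E^*$ with graph $\{(x,x^*): f(x,x^*)=\langle x,x^*\rangle\}$; $\mathcal D$ and $\mathcal R$ denote the domain and the range of a multifunction. $T^{\mathsf T}$ is the adjoint of a bounded linear map $T$, and $\overline h$ is the function whose epigraph is the closure of the epigraph of $h$. \textbf{Theorem.} Let $E$ and $F$ be nonzero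 real Banach spaces, let $\pi_E,\pi_{E^*}$ be the projections of $E\times E^*$ onto $E$ and $E^*$, and $\pi_F,\pi_{F^*}$ those of $F\times F^*$ onto $F$ and $F^*$. Let $f$ be strongly representative on $E\times E^*$ and $g$ be strongly representative on $F\times F^*$. (a) Let $A:E\to F$ be bounded and linear, and let $H$ be a closed linear subspace of $F$ such that $$\mathcal D(\mathcal M g)-A[\mathcal D(\mathcal M f)]\subset H\subset\bigcup_{\lambda>0}\lambda\big[\pi_F\operatorname{dom} g-A(\pi_E\operatorname{dom} f)\big].$$ Then $\bigcup_{\lambda>0}\lambda[\pi_F\operatorname{dom} g-A(\pi_E\operatorname{dom} f)]=H$. Consequently, if $$h(x,x^*):=\inf\{f(x,x^*-A^{\mathsf T}y^*)+g(Ax,y^*): y^*\in F^*\}\qquad((x,x^*)\in E\times E^*),$$ then for all $(x^*,x^{**})\in E^*\times E^{**}$ $$h^*(x^*,x^{**})=\min\{f^*(x^*-A^{\mathsf T}y^*,x^{**})+g^*(y^*,A^{\mathsf{TT}}x^{**}): y^*\in F^*\}$$ (the minimum being attained), and $\overline h$ is strongly representative on $E\times E^*$. (b) Let $B:F\to E$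 be bounded and linear, and let $H$ be a closed linear subspace of $F^*$ such that $$\mathcal R(\mathcal M g)-B^{\mathsf T}[\mathcal R(\mathcal M f)]\subset H\subset\bigcup_{\lambda>0}\lambda\big[\pi_{F^*}\operatorname{dom} g-B^{\mathsf T}(\pi_{E^*}\operatorname{dom} f)\big].$$ Then $\bigcup_{\lambda>0}\lambda[\pi_{F^*}\operatorname{dom} g-B^{\mathsf T}(\pi_{E^*}\operatorname{dom} f)]=H$. Consequently, if $$h(x,x^*):=\inf\{f(x-By,x^*)+g(y,B^{\mathsf T}x^*): y\in F\}\qquad((x,x^*)\in E\times E^*),$$ then for all $(x^*,x^{**})\in E^*\times E^{**}$ $$h^*(x^*,x^{**})=\min\{f^*(x^*,x^{**}-B^{\mathsf{TT}}y^{**})+g^*(B^{\mathsf T}x^*,y^{**}): y^{**}\in F^{**}\}$$ (the minimum being attained), and $\overline h$ is strongly representative on $E\times E^*$. -/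

import Mathlib

open Set Pointwise

namespace Sandwich

noncomputable section

/-- The epigraph of an extended-real-valued function, as a subset of `X × ℝ`. -/
def epi {X : Type*} (f : X → EReal) : Set (X × ℝ) := {p | f p.1 ≤ (p.2 : EReal)}

/-- The effective domain: the set where `f` is not `+∞`. -/
def effDom {X : Type*} (f : X → EReal) : Set X := {x | f x < ⊤}

/-- `f` is a proper, convex, lower semicontinuous function from `X` into `]-∞, ∞]`. -/
structure IsPCLSC {X : Type*} [NormedAddCommGroup X] [NormedSpace ℝ X] (f : X → EReal) :
    Prop where
  ne_bot : ∀ x, f x ≠ ⊥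
  proper : (effDom f).Nonempty
  convex : Convex ℝ (epi f)
  lsc : LowerSemicontinuous f

/-- The Fenchel conjugate `f*(φ) = sup_x [φ x - f x]`, on the dual space. -/
def conj {X : Type*} [NormedAddCommGroup X] [NormedSpace ℝ X] (f : X → EReal)
    (φ : StrongDual ℝ X) : EReal :=
  ⨆ x, ((φ x : ℝ) : EReal) - f x

/-- The conjugate of a function on `E × E*`, as a function on `E* × E**`: the pair `(x*, x**)` is
identified with the functional `(y, y*) ↦ x*(y) + x**(y*)` on `E × E*`. -/
def conjProd {E : Type*} [NormedAddCommGroup E] [NormedSpace ℝ E]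
    (f : E × StrongDual ℝ E → EReal)
    (p : StrongDual ℝ E × StrongDual ℝ (StrongDual ℝ E)) : EReal :=
  conj f (p.1.coprod p.2)

/-- The value at `x` of the function whose epigraph is the closure of the epigraph of `h`
(see `epi_closedHull`). -/
def closedHull {X : Type*} [TopologicalSpace X] (h : X → EReal) (x : X) : EReal :=
  sInf ((fun r : ℝ => (r : EReal)) '' {r : ℝ | (x, r) ∈ closure (epi h)})

/-- `closedHull h` is the function whose epigraph is the closure of the epigraph of `h`. -/
theorem epi_closedHull {X : Type*} [TopologicalSpace X] (h : X → EReal) :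
    epi (closedHull h) = closure (epi h) := by
  have up : ∀ (x : X) (r s : ℝ), r ≤ s → (x, r) ∈ closure (epi h) → (x, s) ∈ closure (epi h) := by
    intro x r s hrs hx
    have hc : Continuous (fun p : X × ℝ => (p.1, p.2 + (s - r))) := by fun_prop
    have hm : MapsTo (fun p : X × ℝ => (p.1, p.2 + (s - r))) (epi h) (epi h) := by
      intro p hp
      exact le_trans (show h p.1 ≤ (p.2 : EReal) from hp)
        (EReal.coe_le_coe_iff.2 (by linarith))
    have := hm.closure hc hx
    simpa using this
  ext ⟨x, r⟩
  constructor
  · intro hr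
    have hr' : closedHull h x ≤ (r : EReal) := hr
    have key : ∀ s : ℝ, r < s → (x, s) ∈ closure (epi h) := by
      intro s hs
      have : closedHull h x < (s : EReal) := lt_of_le_of_lt hr' (EReal.coe_lt_coe_iff.2 hs)
      obtain ⟨_, ⟨t, ht, rfl⟩, hts⟩ := sInf_lt_iff.1 this
      exact up x t s (EReal.coe_lt_coe_iff.1 hts).le ht
    have hcl : IsClosed {s : ℝ | (x, s) ∈ closure (epi h)} :=
      isClosed_closure.preimage (by fun_prop)
    have hsub : closure (Ioi r) ⊆ {s : ℝ | (x, s) ∈ closure (epi h)} :=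
      closure_minimal (fun s hs => key s hs) hcl
    rw [closure_Ioi] at hsub
    exact hsub (le_refl r)
  · intro hr
    show closedHull h x ≤ (r : EReal)
    exact sInf_le (mem_image_of_mem _ hr)

/-- `f` is a representative function on `E × E*`. -/
structure IsRepresentative {E : Type*} [NormedAddCommGroup E] [NormedSpace ℝ E]
    (f : E × StrongDual ℝ E → EReal) : Prop where
  pclsc : IsPCLSC f
  ge_pairing : ∀ (x : E) (x' : StrongDual ℝ E), ((x' x : ℝ) : EReal) ≤ f (x, x')

/-- `f` is a strongly representative function on `E × E*`. -/
structure IsStronglyRepresentative {E : Type*} [NormedAddCommGroup E] [NormedSpace ℝ E]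
    (f : E × StrongDual ℝ E → EReal) : Prop extends IsRepresentative f where
  conj_ge_pairing : ∀ (x' : StrongDual ℝ E) (x'' : StrongDual ℝ (StrongDual ℝ E)),
    ((x'' x' : ℝ) : EReal) ≤ conjProd f (x', x'')

/-- The multifunction `M f : E ⇉ E*`, given by its graph `{(x, x*) : f(x, x*) = ⟨x, x*⟩}`. Its
domain and range are `(multi f).dom` and `(multi f).cod`. -/
def multi {E : Type*} [NormedAddCommGroup E] [NormedSpace ℝ E]
    (f : E × StrongDual ℝ E → EReal) : SetRel E (StrongDual ℝ E) :=
  {p | f p = ((p.2 p.1 : ℝ) : EReal)}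

/-- The adjoint `Tᵀ : Y* → X*`, `y* ↦ y* ∘ T`, of a bounded linear map `T : X → Y`. -/
def adj {X Y : Type*} [NormedAddCommGroup X] [NormedSpace ℝ X]
    [NormedAddCommGroup Y] [NormedSpace ℝ Y] (T : X →L[ℝ] Y) :
    StrongDual ℝ Y →L[ℝ] StrongDual ℝ X :=
  T.precomp ℝ

/-- The set `⋃_{t > 0} t • S`. -/
def coneUnion {X : Type*} [SMul ℝ X] (S : Set X) : Set X := ⋃ t : ℝ, ⋃ _ : 0 < t, t • S

/-- `h(x, x*) = inf {f(x, x* - Aᵀ y*) + g(A x, y*) : y* ∈ F*}`. -/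
def infSum {E F : Type*} [NormedAddCommGroup E] [NormedSpace ℝ E]
    [NormedAddCommGroup F] [NormedSpace ℝ F]
    (f : E × StrongDual ℝ E → EReal) (g : F × StrongDual ℝ F → EReal) (A : E →L[ℝ] F)
    (p : E × StrongDual ℝ E) : EReal :=
  ⨅ y' : StrongDual ℝ F, f (p.1, p.2 - adj A y') + g (A p.1, y')

/-- `h(x, x*) = inf {f(x - B y, x*) + g(y, Bᵀ x*) : y ∈ F}`. -/
def infParallel {E F : Type*} [NormedAddCommGroup E] [NormedSpace ℝ E]
    [NormedAddCommGroup F] [NormedSpace ℝ F]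
    (f : E × StrongDual ℝ E → EReal) (g : F × StrongDual ℝ F → EReal) (B : F →L[ℝ] E)
    (p : E × StrongDual ℝ E) : EReal :=
  ⨅ y : F, f (p.1 - B y, p.2) + g (y, adj B p.2)

end

end Sandwich

/-! Two independent mechanisms combine. The first compares `effDom f` with `multi f`. A
Brøndsted–Rockafellar argument (`IsStronglyRepresentative.exists_mem_multi`) moves a point of
`effDom f` to the graph of `multi f`, with a free parameter that trades closeness in one coordinate
for closeness in the other. So the projections of `effDom f` lie in the closures of the domain and
range of `multi f`. As `H` is a closed subspace, it then contains the whole cone, which gives the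
equality. The second is Attouch–Brezis duality. An upper bound on the conjugate of the infimum
bounds a linear functional below on pairs of epigraph points subject to `w = A p`. Perturbing this
constraint inside `H`, Baire category and Hahn–Banach yield a Lagrange multiplier
(`exists_multiplier`), and this is the minimizing dual variable. Strong representativity follows
because the pairings of the two summands add up to the pairing at the given point, both for the
functions and for their conjugates. Case (b) is case (a) with coordinates swapped: `marginalSum`
allows any `D`, not only an adjoint, so `A` and `D` become `adj B` and `B`. -/

namespace Sandwich

open Filter Topology

/-! ### Open mapping for convex sets and Lagrange multipliers -/

section Multiplier

variable {Z Y : Type*} [NormedAddCommGroup Z] [NormedSpace ℝ Z]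
  [NormedAddCommGroup Y] [NormedSpace ℝ Y]

/-- The weights sum to one: the leftover `2⁻ᴺ` sits at `g`. This keeps partial sums of a dyadic
series inside a convex set, so that closedness can be applied to them. -/
theorem dyadic_sum_mem {V : Type*} [AddCommGroup V] [Module ℝ V] {G : Set V}
    (hG : Convex ℝ G) {g : V} (hg : g ∈ G) (N : ℕ) (a : ℕ → V) (ha : ∀ k, a k ∈ G) :
    ∑ k ∈ Finset.range N, (2⁻¹ : ℝ) ^ (k + 1) • a k + (2⁻¹ : ℝ) ^ N • g ∈ G := by
  induction N generalizing a with
  | zero => simpa using hg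
  | succ N ih =>
    have h := hG (ha 0) (ih (fun k => a (k + 1)) fun k => ha _)
      (by norm_num : (0 : ℝ) ≤ 2⁻¹) (by norm_num : (0 : ℝ) ≤ 2⁻¹) (by norm_num)
    convert h using 1
    rw [Finset.sum_range_succ', smul_add, Finset.smul_sum, smul_smul, pow_succ' _ N]
    simp only [smul_smul, ← pow_succ']
    simp only [zero_add, pow_one]
    abel

/-- If a closed convex set `K ⊆ Z × Y` has an absorbing projection to `Y`, then a ball of `Y` lies
in the projection of a norm-bounded part of `K`. -/
theorem exists_ball_of_absorbing [CompleteSpace Z] [CompleteSpace Y] {K : Set (Z × Y)}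
    (hK : IsClosed K) (hc : Convex ℝ K) (habs : ∀ v, ∃ t : ℝ, 0 < t ∧ ∃ z, (z, t • v) ∈ K) :
    ∃ δ > (0 : ℝ), ∃ n : ℝ, ∀ v, ‖v‖ < δ → ∃ z, ‖z‖ ≤ n ∧ (z, v) ∈ K := by
  obtain ⟨t₀, -, z₀, h₀⟩ := habs 0
  rw [smul_zero] at h₀
  -- The extra unit leaves room for a scaled-down point of `K`, combined with `z₀`.
  set n : ℝ := ‖z₀‖ + 1 with hn
  set G : Set (Z × Y) := {p | ‖p.1‖ ≤ n} ∩ K with hG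
  have hGc : Convex ℝ G := by
    refine Convex.inter ?_ hc
    have heq : {p : Z × Y | ‖p.1‖ ≤ n} = LinearMap.fst ℝ Z Y ⁻¹' Metric.closedBall 0 n := by
      ext p
      simp
    rw [heq]
    exact (convex_closedBall (0 : Z) n).linear_preimage (LinearMap.fst ℝ Z Y)
  have hg₀ : (z₀, (0 : Y)) ∈ G := ⟨by simp [hn], h₀⟩
  set C : Set Y := Prod.snd '' G with hC
  have hCc : Convex ℝ C := hGc.linear_image (LinearMap.snd ℝ Z Y)
  have hCabs : ∀ v, ∃ k : ℕ, ((k : ℝ) + 1)⁻¹ • v ∈ C := by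
    intro v
    obtain ⟨t, ht, z, hz⟩ := habs v
    obtain ⟨k, hk⟩ := exists_nat_gt ((‖z‖ + 1) / t + 1 / t)
    have hk0 : (0 : ℝ) < (k : ℝ) + 1 := by positivity
    have hkt : ‖z‖ + 2 < k * t := by
      have : (‖z‖ + 1) / t + 1 / t = (‖z‖ + 2) / t := by ring
      rw [this, div_lt_iff₀ ht] at hk
      exact hk
    set s : ℝ := (((k : ℝ) + 1) * t)⁻¹ with hs
    have hs0 : 0 < s := by positivity
    have hs1 : s * (‖z‖ + 2) ≤ 1 := by
      rw [hs, inv_mul_le_iff₀ (by positivity)]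
      nlinarith
    have hs2 : s ≤ 1 := by nlinarith [norm_nonneg z]
    have hmem := hc hz h₀ hs0.le (by linarith : 0 ≤ 1 - s) (by ring)
    refine ⟨k, _, ⟨?_, hmem⟩, ?_⟩
    · have h1 : ‖s • z‖ ≤ 1 := by
        rw [norm_smul, Real.norm_of_nonneg hs0.le]; nlinarith
      have h2 : ‖(1 - s) • z₀‖ ≤ ‖z₀‖ := by
        rw [norm_smul, Real.norm_of_nonneg (by linarith)]
        nlinarith [norm_nonneg z₀]
      calc ‖s • z + (1 - s) • z₀‖ ≤ ‖s • z‖ + ‖(1 - s) • z₀‖ := norm_add_le _ _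
        _ ≤ n := by linarith
    · simp only [Prod.smul_mk, Prod.mk_add_mk, smul_zero, add_zero, smul_smul]
      congr 1
      rw [hs]
      field_simp
  -- Baire: the closed multiples `(k + 1) • closure C` cover `Y`.
  obtain ⟨k, hk⟩ := nonempty_interior_of_iUnion_of_closed
    (f := fun k : ℕ => {v : Y | ((k : ℝ) + 1)⁻¹ • v ∈ closure C})
    (fun k => isClosed_closure.preimage (continuous_const_smul _))
    (eq_univ_of_forall fun v => by
      obtain ⟨k, hk⟩ := hCabs v
      exact mem_iUnion.2 ⟨k, subset_closure hk⟩)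
  have hint : (interior (closure C)).Nonempty := by
    obtain ⟨v, hv⟩ := hk
    have hk0 : ((k : ℝ) + 1)⁻¹ ≠ 0 := by positivity
    refine ⟨((k : ℝ) + 1)⁻¹ • v, ?_⟩
    have heq := (Homeomorph.smulOfNeZero (((k : ℝ) + 1)⁻¹) hk0 : Y ≃ₜ Y).preimage_interior
      (closure C)
    change v ∈ (Homeomorph.smulOfNeZero (((k : ℝ) + 1)⁻¹) hk0 : Y ≃ₜ Y) ⁻¹' interior (closure C)
    rw [heq]
    exact hv
  -- `0` lies strictly between an interior point `w` and a point `-s • w` of `C`.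
  have h0 : (0 : Y) ∈ interior (closure C) := by
    obtain ⟨w, hw⟩ := hint
    obtain ⟨k, hk⟩ := hCabs (-w)
    set s : ℝ := ((k : ℝ) + 1)⁻¹ with hs
    have hs0 : 0 < s := by positivity
    have := hCc.closure.combo_interior_self_mem_interior hw (subset_closure hk)
      (a := s / (1 + s)) (b := 1 / (1 + s)) (by positivity) (by positivity) (by field_simp; ring)
    convert this using 1
    rw [smul_smul, smul_neg, ← sub_eq_add_neg, ← sub_smul]
    rw [show s / (1 + s) - 1 / (1 + s) * s = 0 by ring, zero_smul]
  obtain ⟨δ, hδ, hball⟩ := Metric.mem_nhds_iff.1 (mem_interior_iff_mem_nhds.1 h0)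
  -- As in the open mapping theorem: approximate within `δ / 2`, then double the residual to return
  -- to the ball. Iterating from `2 • v` writes `v` as a dyadic series of points of `C`.
  have hstep : ∀ v : Metric.ball (0 : Y) δ, ∃ p : G, ∃ w : Metric.ball (0 : Y) δ,
      (w : Y) = (2 : ℝ) • ((v : Y) - p.1.2) := by
    rintro ⟨v, hv⟩
    obtain ⟨c, ⟨p, hp, rfl⟩, hpc⟩ := Metric.mem_closure_iff.1 (hball hv) (δ / 2) (by positivity)
    refine ⟨⟨p, hp⟩, ⟨(2 : ℝ) • (v - p.2), ?_⟩, rfl⟩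
    rw [mem_ball_zero_iff, norm_smul, Real.norm_of_nonneg (by norm_num)]
    rw [dist_eq_norm] at hpc
    linarith
  choose P W hW using hstep
  refine ⟨δ / 2, by positivity, n, fun v hv => ?_⟩
  have hv2 : (2 : ℝ) • v ∈ Metric.ball (0 : Y) δ := by
    rw [mem_ball_zero_iff, norm_smul, Real.norm_of_nonneg (by norm_num)]
    linarith
  let u : ℕ → Metric.ball (0 : Y) δ := fun k => W^[k] ⟨_, hv2⟩
  let a : ℕ → Z × Y := fun k => (P (u k)).1
  have haG : ∀ k, a k ∈ G := fun k => (P (u k)).2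
  have hu : ∀ k, ((u (k + 1) : Y)) = (2 : ℝ) • ((u k : Y) - (a k).2) := by
    intro k
    show ((W^[k + 1] _ : Metric.ball (0 : Y) δ) : Y) = _
    rw [Function.iterate_succ_apply']
    exact hW _
  have hsum2 : ∀ N : ℕ, ∑ k ∈ Finset.range N, (2⁻¹ : ℝ) ^ (k + 1) • (a k).2
      = v - (2⁻¹ : ℝ) ^ (N + 1) • (u N : Y) := by
    intro N
    induction N with
    | zero =>
      show (0 : Y) = v - (2⁻¹ : ℝ) ^ (0 + 1) • ((2 : ℝ) • v)
      rw [smul_smul]; norm_num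
    | succ N ih =>
      rw [Finset.sum_range_succ, ih, hu N, smul_smul, pow_succ _ (N + 1), mul_assoc]
      norm_num [smul_sub]
      abel
  have hpow : Tendsto (fun N : ℕ => (2⁻¹ : ℝ) ^ N) atTop (𝓝 0) :=
    tendsto_pow_atTop_nhds_zero_of_lt_one (by norm_num) (by norm_num)
  have hlim2 : Tendsto (fun N => ∑ k ∈ Finset.range N, (2⁻¹ : ℝ) ^ (k + 1) • (a k).2)
      atTop (𝓝 v) := by
    have hz : Tendsto (fun N : ℕ => (2⁻¹ : ℝ) ^ (N + 1) • (u N : Y)) atTop (𝓝 0) := by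
      refine squeeze_zero_norm (a := fun N => (2⁻¹ : ℝ) ^ (N + 1) * δ) (fun N => ?_) ?_
      · rw [norm_smul, norm_pow, Real.norm_of_nonneg (by norm_num)]
        have := (mem_ball_zero_iff.1 (u N).2).le
        gcongr
      · simpa using ((tendsto_add_atTop_iff_nat 1).2 hpow).mul_const δ
    simp_rw [hsum2]
    simpa using tendsto_const_nhds.sub hz
  have hsummable : Summable fun k => (2⁻¹ : ℝ) ^ (k + 1) • (a k).1 := by
    refine Summable.of_norm_bounded (g := fun k => (2⁻¹ : ℝ) ^ k * n) ?_ fun k => ?_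
    · exact (summable_geometric_of_lt_one (by norm_num) (by norm_num)).mul_right n
    · rw [norm_smul, norm_pow, Real.norm_of_nonneg (by norm_num)]
      have h1 : ‖(a k).1‖ ≤ n := (haG k).1
      have h2 : (2⁻¹ : ℝ) ^ (k + 1) ≤ 2⁻¹ ^ k :=
        pow_le_pow_of_le_one (by norm_num) (by norm_num) (Nat.le_succ k)
      gcongr
  obtain ⟨z, hz⟩ := hsummable
  have hlim1 := hz.tendsto_sum_nat
  have hGcl : IsClosed G := (isClosed_le (by fun_prop) (by fun_prop)).inter hK
  have hlim : Tendsto (fun N => ∑ k ∈ Finset.range N, (2⁻¹ : ℝ) ^ (k + 1) • a k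
      + (2⁻¹ : ℝ) ^ N • (z₀, (0 : Y))) atTop (𝓝 (z, v)) := by
    have h1 := (hlim1.prodMk_nhds hlim2).add (hpow.smul_const (z₀, (0 : Y)))
    rw [zero_smul, add_zero] at h1
    convert h1 using 3 with N
    ext <;> simp [Prod.fst_sum, Prod.snd_sum]
  have := hGcl.mem_of_tendsto hlim
    (Eventually.of_forall fun N => dyadic_sum_mem hGc hg₀ N a haG)
  exact ⟨z, this⟩

/-- Existence of a Lagrange multiplier for minimizing `ℓ` over `{z | (z, 0) ∈ K}`. -/
theorem exists_multiplier_of_absorbing [CompleteSpace Z] [CompleteSpace Y] {K : Set (Z × Y)}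
    (hK : IsClosed K) (hc : Convex ℝ K) (habs : ∀ v, ∃ t : ℝ, 0 < t ∧ ∃ z, (z, t • v) ∈ K)
    (l : StrongDual ℝ Z) (c : ℝ) (hl : ∀ z, (z, 0) ∈ K → c ≤ l z) :
    ∃ η : StrongDual ℝ Y, ∀ z v, (z, v) ∈ K → c + η v ≤ l z := by
  obtain ⟨δ, hδ, n, hn⟩ := exists_ball_of_absorbing hK hc habs
  -- Essentially the epigraph of the value function `v ↦ inf {l z | (z, v) ∈ K}`. The ball found
  -- above bounds this function near `0`, and `η` is obtained as a subgradient.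
  set S : Set (Y × ℝ) := {p | ∃ z, (z, p.1) ∈ K ∧ l z ≤ p.2} with hS
  have hSc : Convex ℝ S := by
    rintro p ⟨z, hz, hp⟩ q ⟨w, hw, hq⟩ a b ha hb hab
    refine ⟨a • z + b • w, hc hz hw ha hb hab, ?_⟩
    simp only [map_add, map_smul, smul_eq_mul, Prod.snd_add, Prod.smul_snd]
    gcongr
  have hup : ∀ R, ‖l‖ * n < R → ((0 : Y), R) ∈ interior S := by
    intro R hR
    rw [mem_interior]
    refine ⟨Metric.ball 0 δ ×ˢ Ioi (‖l‖ * n), ?_, Metric.isOpen_ball.prod isOpen_Ioi,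
      ⟨Metric.mem_ball_self hδ, hR⟩⟩
    rintro ⟨v, r⟩ ⟨hv, hr⟩
    obtain ⟨z, hz, hzK⟩ := hn v (mem_ball_zero_iff.1 hv)
    refine ⟨z, hzK, ?_⟩
    calc l z ≤ ‖l z‖ := le_abs_self _
      _ ≤ ‖l‖ * ‖z‖ := l.le_opNorm z
      _ ≤ ‖l‖ * n := by gcongr
      _ ≤ r := le_of_lt hr
  have hnot : ((0 : Y), c) ∉ interior S := by
    intro h
    have hcont : Continuous fun r : ℝ => ((0 : Y), c - r) := by fun_prop
    have h1 : (fun r : ℝ => ((0 : Y), c - r)) ⁻¹' interior S ∈ 𝓝 0 :=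
      hcont.continuousAt.preimage_mem_nhds
        (by simpa using isOpen_interior.mem_nhds h)
    obtain ⟨ε, hε, hball⟩ := Metric.mem_nhds_iff.1 h1
    have h2 : ε / 2 ∈ Metric.ball (0 : ℝ) ε := by
      rw [mem_ball_zero_iff, Real.norm_of_nonneg (by positivity)]; linarith
    obtain ⟨z, hz, hzl⟩ := interior_subset (hball h2)
    have := hl z hz
    dsimp at hzl
    linarith
  obtain ⟨Λ, hΛ⟩ := geometric_hahn_banach_open_point hSc.interior isOpen_interior hnot
  set s := Λ (0, 1) with hs
  set φ : StrongDual ℝ Y := Λ.comp (ContinuousLinearMap.inl ℝ Y ℝ) with hφ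
  have hdec : ∀ v r, Λ (v, r) = φ v + r * s := by
    intro v r
    have : (v, r) = (v, (0 : ℝ)) + r • ((0 : Y), (1 : ℝ)) := by simp
    rw [this, map_add, map_smul]
    rfl
  -- The separating hyperplane is not vertical, since `S` has interior points directly above `(0,
  -- c)`.
  have hs0 : s < 0 := by
    have h1 := hΛ _ (hup (max (‖l‖ * n) c + 1) (by linarith [le_max_left (‖l‖ * n) c]))
    rw [hdec, hdec] at h1
    have := le_max_right (‖l‖ * n) c
    nlinarith
  have hle : ∀ p ∈ S, Λ p ≤ Λ (0, c) := by
    have hcl : closure (interior S) ⊆ {p | Λ p ≤ Λ (0, c)} :=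
      closure_minimal (fun p hp => (hΛ p hp).le) (isClosed_le Λ.continuous continuous_const)
    rw [hSc.closure_interior_eq_closure_of_nonempty_interior
      ⟨_, hup (‖l‖ * n + 1) (by linarith)⟩] at hcl
    exact fun p hp => hcl (subset_closure hp)
  refine ⟨(-s)⁻¹ • φ, fun z v hzv => ?_⟩
  have h1 := hle (v, l z) ⟨z, hzv, le_rfl⟩
  rw [hdec, hdec, map_zero] at h1
  have h2 : 0 < -s := by linarith
  have h3 : φ v ≤ (-s) * (l z - c) := by linarith
  have h4 : (-s)⁻¹ * φ v ≤ l z - c := by rwa [inv_mul_le_iff₀ h2]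
  simp only [_root_.smul_apply, smul_eq_mul]
  linarith

/-- A closed `H` is a Banach space in which the constraint set is absorbing; the multiplier found on
`H` extends by Hahn–Banach. -/
theorem exists_multiplier [CompleteSpace Z] [CompleteSpace Y] {K : Set (Z × Y)}
    (hK : IsClosed K) (hc : Convex ℝ K) (H : Submodule ℝ Y) (hH : IsClosed (H : Set Y))
    (hKH : ∀ z v, (z, v) ∈ K → v ∈ H)
    (habs : ∀ v ∈ H, ∃ t : ℝ, 0 < t ∧ ∃ z, (z, t • v) ∈ K)
    (l : StrongDual ℝ Z) (c : ℝ) (hl : ∀ z, (z, 0) ∈ K → c ≤ l z) :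
    ∃ η : StrongDual ℝ Y, ∀ z v, (z, v) ∈ K → c + η v ≤ l z := by
  have : CompleteSpace H := hH.completeSpace_coe
  let i : Z × H →L[ℝ] Z × Y := (ContinuousLinearMap.id ℝ Z).prodMap H.subtypeL
  obtain ⟨η, hη⟩ := exists_multiplier_of_absorbing (K := i ⁻¹' K) (hK.preimage i.continuous)
    (hc.linear_preimage i.toLinearMap) (fun v => habs v v.2) l c (fun z hz => hl z hz)
  obtain ⟨η', hη', -⟩ := exists_extension_norm_eq H η
  refine ⟨η', fun z v hzv => ?_⟩
  have := hη z ⟨v, hKH z v hzv⟩ hzv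
  rw [← hη'] at this
  exact this

end Multiplier

/-! ### Epigraphs and Fenchel conjugates -/

theorem mem_epi {X : Type*} {f : X → EReal} {p : X × ℝ} : p ∈ epi f ↔ f p.1 ≤ (p.2 : EReal) := Iff.rfl

theorem isClosed_epi {X : Type*} [TopologicalSpace X] {f : X → EReal} (hf : LowerSemicontinuous f) : IsClosed (epi f) :=
  (lowerSemicontinuous_iff_isClosed_epigraph.1 hf).preimage
    (continuous_fst.prodMk (continuous_coe_real_ereal.comp continuous_snd))

theorem lowerSemicontinuous_of_isClosed_epi {X : Type*} [TopologicalSpace X] {f : X → EReal} (hbot : ∀ x, f x ≠ ⊥)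
    (hf : IsClosed (epi f)) : LowerSemicontinuous f := by
  rw [lowerSemicontinuous_iff_isClosed_preimage]
  intro y
  induction y with
  | bot =>
    have : f ⁻¹' Iic ⊥ = ∅ := by
      ext x
      simp [hbot x]
    rw [this]
    exact isClosed_empty
  | top => simp
  | coe r =>
    have hc : Continuous fun x : X => (x, r) := by fun_prop
    exact hf.preimage hc

section Conjugate

variable {X : Type*} [NormedAddCommGroup X] [NormedSpace ℝ X]

theorem IsPCLSC.exists_eq_coe {f : X → EReal} (hf : IsPCLSC f) {x : X} (hx : x ∈ effDom f) :
    ∃ r : ℝ, f x = r :=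
  ⟨(f x).toReal, (EReal.coe_toReal (ne_of_lt hx) (hf.ne_bot x)).symm⟩

theorem conj_le_coe_iff {f : X → EReal} {φ : StrongDual ℝ X} {c : ℝ} :
    conj f φ ≤ c ↔ ∀ x, ((φ x - c : ℝ) : EReal) ≤ f x := by
  refine iSup_le_iff.trans (forall_congr' fun x => ?_)
  induction f x with
  | bot => simp [-EReal.coe_sub]
  | top => simp
  | coe r =>
    rw [← EReal.coe_sub, EReal.coe_le_coe_iff, EReal.coe_le_coe_iff]
    constructor <;> intro h <;> linarith

theorem conj_le_coe_iff_epi {f : X → EReal} {φ : StrongDual ℝ X} {c : ℝ} :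
    conj f φ ≤ c ↔ ∀ p ∈ epi f, φ p.1 - p.2 ≤ c := by
  rw [conj_le_coe_iff]
  constructor
  · rintro h ⟨x, r⟩ hp
    have := EReal.coe_le_coe_iff.1 ((h x).trans hp)
    dsimp only
    linarith
  · intro h x
    refine EReal.le_of_forall_lt_iff_le.1 fun r hr => ?_
    have := h (x, r) hr.le
    dsimp only at this
    exact EReal.coe_le_coe_iff.2 (by linarith)

theorem conj_ne_bot {f : X → EReal} (hf : (effDom f).Nonempty) (φ : StrongDual ℝ X) :
    conj f φ ≠ ⊥ := by
  obtain ⟨x, hx⟩ := hf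
  intro h
  have h1 : ((φ x : ℝ) : EReal) - f x ≤ ⊥ := h ▸ le_iSup (fun x => ((φ x : ℝ) : EReal) - f x) x
  have hx' : f x < ⊤ := hx
  induction hfx : f x with
  | bot => simp [hfx] at h1
  | top => simp [hfx] at hx'
  | coe r =>
    rw [hfx, ← EReal.coe_sub, le_bot_iff] at h1
    exact EReal.coe_ne_bot _ h1

theorem conj_anti {f g : X → EReal} (h : ∀ x, f x ≤ g x) (φ : StrongDual ℝ X) :
    conj g φ ≤ conj f φ :=
  iSup_mono fun x => EReal.sub_le_sub le_rfl (h x)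

/-- The two suprema are taken separately. A finite point of `g` first shows that `conj f φ` is real,
so it can be moved across the inequality. -/
theorem conj_add_conj_le {X' : Type*} [NormedAddCommGroup X'] [NormedSpace ℝ X']
    {f : X → EReal} {g : X' → EReal} (hf : (effDom f).Nonempty) (hg : (effDom g).Nonempty)
    {φ : StrongDual ℝ X} {ψ : StrongDual ℝ X'} {c : ℝ}
    (h : ∀ p ∈ epi f, ∀ q ∈ epi g, (φ p.1 - p.2) + (ψ q.1 - q.2) ≤ c) :
    conj f φ + conj g ψ ≤ c := by
  obtain ⟨y, hy⟩ := hg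
  obtain ⟨s, hs, -⟩ := EReal.lt_iff_exists_real_btwn.1 (show g y < ⊤ from hy)
  have hfle : conj f φ ≤ ((c - (ψ y - s) : ℝ) : EReal) :=
    conj_le_coe_iff_epi.2 fun p hp => by
      have := h p hp (y, s) hs.le
      dsimp only at this
      linarith
  have hα : conj f φ = ((conj f φ).toReal : EReal) :=
    (EReal.coe_toReal (ne_top_of_le_ne_top (EReal.coe_ne_top _) hfle) (conj_ne_bot hf φ)).symm
  set α := (conj f φ).toReal
  have hgle : conj g ψ ≤ ((c - α : ℝ) : EReal) :=
    conj_le_coe_iff_epi.2 fun q hq => by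
      have : conj f φ ≤ ((c - (ψ q.1 - q.2) : ℝ) : EReal) :=
        conj_le_coe_iff_epi.2 fun p hp => by linarith [h p hp q hq]
      rw [hα, EReal.coe_le_coe_iff] at this
      linarith
  calc conj f φ + conj g ψ ≤ (α : EReal) + ((c - α : ℝ) : EReal) := by
        rw [hα]
        gcongr
    _ = c := by
      rw [← EReal.coe_add]
      congr 1
      ring

theorem conj_comp_swap {X' : Type*} [NormedAddCommGroup X'] [NormedSpace ℝ X']
    (f : X × X' → EReal) (φ : StrongDual ℝ X) (ψ : StrongDual ℝ X') :
    conj (f ∘ Prod.swap) (ψ.coprod φ) = conj f (φ.coprod ψ) := by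
  unfold conj
  rw [← (Equiv.prodComm X X').iSup_comp]
  refine iSup_congr fun x => ?_
  simp [add_comm]

theorem IsPCLSC.comp_swap {X' : Type*} [NormedAddCommGroup X'] [NormedSpace ℝ X']
    {f : X × X' → EReal} (hf : IsPCLSC f) : IsPCLSC (f ∘ Prod.swap) where
  ne_bot x := hf.ne_bot _
  proper := by
    obtain ⟨x, hx⟩ := hf.proper
    exact ⟨x.swap, by simpa [effDom] using hx⟩
  convex := by
    rintro ⟨p, r⟩ hp ⟨q, s⟩ hq a b ha hb hab
    exact hf.convex (show (p.swap, r) ∈ epi f from hp) (show (q.swap, s) ∈ epi f from hq) ha hb hab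
  lsc := hf.lsc.comp continuous_swap

end Conjugate

/-! ### Duality for marginal sums -/

section MarginalSum

variable {P Q R S : Type*} [NormedAddCommGroup P] [NormedSpace ℝ P]
  [NormedAddCommGroup Q] [NormedSpace ℝ Q] [NormedAddCommGroup R] [NormedSpace ℝ R]
  [NormedAddCommGroup S] [NormedSpace ℝ S]

/-- The common form of `infSum` and `infParallel`:
`(p, q) ↦ inf {f(p, q - D s) + g(A p, s) : s ∈ S}`. -/
noncomputable def marginalSum (f : P × Q → EReal) (g : R × S → EReal) (A : P →L[ℝ] R)
    (D : S →L[ℝ] Q) (p : P × Q) : EReal :=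
  ⨅ s : S, f (p.1, p.2 - D s) + g (A p.1, s)

variable {f : P × Q → EReal} {g : R × S → EReal} {A : P →L[ℝ] R} {D : S →L[ℝ] Q}

theorem marginalSum_le {p : P} {q : Q} {s : S} {a b : ℝ} (hf : f (p, q) ≤ a)
    (hg : g (A p, s) ≤ b) : marginalSum f g A D (p, q + D s) ≤ ((a + b : ℝ) : EReal) := by
  refine (iInf_le _ s).trans ?_
  rw [EReal.coe_add]
  dsimp only
  rw [add_sub_cancel_right]
  exact add_le_add hf hg

theorem exists_of_marginalSum_lt (hf : ∀ x, f x ≠ ⊥) (hg : ∀ x, g x ≠ ⊥) {p : P × Q} {r : ℝ}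
    (h : marginalSum f g A D p < r) :
    ∃ (s : S) (a b : ℝ), f (p.1, p.2 - D s) ≤ a ∧ g (A p.1, s) ≤ b ∧ a + b < r := by
  obtain ⟨s, hs⟩ := iInf_lt_iff.1 h
  have hsum : f (p.1, p.2 - D s) + g (A p.1, s) ≠ ⊤ := ne_top_of_lt hs
  have hf' : f (p.1, p.2 - D s) ≠ ⊤ := fun h => hsum (by rw [h, EReal.top_add_of_ne_bot (hg _)])
  have hg' : g (A p.1, s) ≠ ⊤ := fun h => hsum (by rw [h, EReal.add_top_of_ne_bot (hf _)])
  have ha := EReal.coe_toReal hf' (hf _)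
  have hb := EReal.coe_toReal hg' (hg _)
  refine ⟨s, _, _, ha.ge, hb.ge, ?_⟩
  rw [← ha, ← hb, ← EReal.coe_add] at hs
  exact EReal.coe_lt_coe_iff.1 hs

theorem convex_epi_marginalSum (hf : ∀ x, f x ≠ ⊥) (hg : ∀ x, g x ≠ ⊥)
    (hfc : Convex ℝ (epi f)) (hgc : Convex ℝ (epi g)) :
    Convex ℝ (epi (marginalSum f g A D)) := by
  rintro ⟨⟨p, q⟩, r⟩ h ⟨⟨p', q'⟩, r'⟩ h' a b ha hb hab
  refine EReal.le_of_forall_lt_iff_le.1 fun z hz => ?_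
  simp only [Prod.smul_mk, Prod.mk_add_mk, smul_eq_mul, EReal.coe_lt_coe_iff] at hz ⊢
  -- The infimum need not be attained, so both points are chosen with slack `ε`.
  set ε := z - (a * r + b * r') with hε
  have hε0 : 0 < ε := by linarith
  obtain ⟨s, α, β, hα, hβ, hlt⟩ := exists_of_marginalSum_lt hf hg
    (lt_of_le_of_lt (mem_epi.1 h) (EReal.coe_lt_coe_iff.2 (show r < r + ε by linarith)))
  obtain ⟨s', α', β', hα', hβ', hlt'⟩ := exists_of_marginalSum_lt hf hg
    (lt_of_le_of_lt (mem_epi.1 h') (EReal.coe_lt_coe_iff.2 (show r' < r' + ε by linarith)))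
  have h1 := hfc (x := ((p, q - D s), α)) (y := ((p', q' - D s'), α')) hα hα' ha hb hab
  have h2 := hgc (x := ((A p, s), β)) (y := ((A p', s'), β')) hβ hβ' ha hb hab
  simp only [Prod.smul_mk, Prod.mk_add_mk, smul_eq_mul, mem_epi, ← map_smul, ← map_add] at h1 h2
  have h3 := marginalSum_le (D := D) h1 h2
  have e : a • (q - D s) + b • (q' - D s') + D (a • s + b • s') = a • q + b • q' := by
    simp only [map_add, map_smul, smul_sub]
    abel
  rw [e] at h3
  refine h3.trans (EReal.coe_le_coe_iff.2 ?_)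
  nlinarith

/-- Weak duality: the Fenchel–Young inequalities at `(p, q - D s)` and `(A p, s)` are added, and the
`η` terms cancel. -/
theorem conj_marginalSum_le (hf : IsPCLSC f) (hg : IsPCLSC g) (φ : StrongDual ℝ P)
    (ψ : StrongDual ℝ Q) (η : StrongDual ℝ R) :
    conj (marginalSum f g A D) (φ.coprod ψ) ≤
      conj f ((φ - adj A η).coprod ψ) + conj g (η.coprod (adj D ψ)) := by
  have hfb := conj_ne_bot hf.proper ((φ - adj A η).coprod ψ)
  have hgb := conj_ne_bot hg.proper (η.coprod (adj D ψ))
  by_cases hft : conj f ((φ - adj A η).coprod ψ) = ⊤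
  · rw [hft, EReal.top_add_of_ne_bot hgb]
    exact le_top
  by_cases hgt : conj g (η.coprod (adj D ψ)) = ⊤
  · rw [hgt, EReal.add_top_of_ne_bot hfb]
    exact le_top
  have hα := EReal.coe_toReal hft hfb
  have hβ := EReal.coe_toReal hgt hgb
  set α := (conj f ((φ - adj A η).coprod ψ)).toReal
  set β := (conj g (η.coprod (adj D ψ))).toReal
  rw [← hα, ← hβ, ← EReal.coe_add, conj_le_coe_iff]
  rintro ⟨p, q⟩
  refine le_iInf fun s => ?_
  have h1 := conj_le_coe_iff.1 hα.ge (p, q - D s)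
  have h2 := conj_le_coe_iff.1 hβ.ge (A p, s)
  refine le_trans (le_of_eq ?_) (add_le_add h1 h2)
  rw [← EReal.coe_add, EReal.coe_eq_coe_iff]
  simp [adj]
  ring

theorem mem_effDom_marginalSum {p : P} {q : Q} {s : S} (hf : (p, q) ∈ effDom f)
    (hg : (A p, s) ∈ effDom g) : (p, q + D s) ∈ effDom (marginalSum f g A D) := by
  refine lt_of_le_of_lt
    (iInf_le (fun t => f (p, q + D s - D t) + g (A p, t)) s) ?_
  rw [add_sub_cancel_right]
  exact EReal.add_lt_top (ne_of_lt hf) (ne_of_lt hg)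

theorem mem_coneUnion {V : Type*} [AddCommGroup V] [Module ℝ V] {T : Set V} {v : V} :
    v ∈ coneUnion T ↔ ∃ t : ℝ, 0 < t ∧ t • v ∈ T := by
  simp only [coneUnion, mem_iUnion, exists_prop]
  constructor
  · rintro ⟨t, ht, h⟩
    exact ⟨t⁻¹, inv_pos.2 ht, (mem_smul_set_iff_inv_smul_mem₀ ht.ne' _ _).1 h⟩
  · rintro ⟨t, ht, h⟩
    refine ⟨t⁻¹, inv_pos.2 ht, (mem_smul_set_iff_inv_smul_mem₀ (inv_pos.2 ht).ne' _ _).2 ?_⟩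
    rwa [inv_inv]

theorem mem_fst_effDom_sub {Q S : Type*} {f : P × Q → EReal} {g : R × S → EReal} {v : R} :
    v ∈ Prod.fst '' effDom g - A '' (Prod.fst '' effDom f) ↔
      ∃ p q s, (p, q) ∈ effDom f ∧ (A p + v, s) ∈ effDom g := by
  rw [Set.mem_sub]
  constructor
  · rintro ⟨_, ⟨⟨w, s⟩, hg, rfl⟩, _, ⟨_, ⟨⟨p, q⟩, hf, rfl⟩, rfl⟩, rfl⟩
    exact ⟨p, q, s, hf, by simpa using hg⟩
  · rintro ⟨p, q, s, hf, hg⟩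
    exact ⟨_, ⟨_, hg, rfl⟩, _, ⟨_, ⟨_, hf, rfl⟩, rfl⟩, by simp⟩

/-- The multiplier lemma is applied to pairs of epigraph points, one of `f` over `(p, q)` and one of
`g` over `(A p + v, s)`, where `v` perturbs the constraint. The values of `v` that occur are exactly
the set whose cone is `H`. Here `q` is the argument of `f`, so `h` is evaluated at `q + D s`; this
explains the term `ψ (D s)` in `l`. -/
theorem exists_conj_add_conj_le [CompleteSpace P] [CompleteSpace Q] [CompleteSpace R]
    [CompleteSpace S] (hf : IsPCLSC f) (hg : IsPCLSC g) (H : Submodule ℝ R)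
    (hH : IsClosed (H : Set R))
    (hcone : coneUnion (Prod.fst '' effDom g - A '' (Prod.fst '' effDom f)) = (H : Set R))
    (φ : StrongDual ℝ P) (ψ : StrongDual ℝ Q) {c : ℝ}
    (hc : conj (marginalSum f g A D) (φ.coprod ψ) ≤ c) :
    ∃ η : StrongDual ℝ R,
      conj f ((φ - adj A η).coprod ψ) + conj g (η.coprod (adj D ψ)) ≤ c := by
  let Lf : (((P × Q) × ℝ) × (S × ℝ)) × R →L[ℝ] (P × Q) × ℝ :=
    (ContinuousLinearMap.fst ℝ _ _).comp (ContinuousLinearMap.fst ℝ _ _)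
  let Lg : (((P × Q) × ℝ) × (S × ℝ)) × R →L[ℝ] (R × S) × ℝ :=
    (((A.comp ((ContinuousLinearMap.fst ℝ _ _).comp ((ContinuousLinearMap.fst ℝ _ _).comp Lf))
      + ContinuousLinearMap.snd ℝ _ _).prod ((ContinuousLinearMap.fst ℝ _ _).comp
        ((ContinuousLinearMap.snd ℝ _ _).comp (ContinuousLinearMap.fst ℝ _ _))))).prod
      ((ContinuousLinearMap.snd ℝ _ _).comp
        ((ContinuousLinearMap.snd ℝ _ _).comp (ContinuousLinearMap.fst ℝ _ _)))
  have hLf : ∀ p q r s r' v, Lf ((((p, q), r), (s, r')), v) = ((p, q), r) := fun _ _ _ _ _ _ => rfl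
  have hLg : ∀ p q r s r' v, Lg ((((p, q), r), (s, r')), v) = ((A p + v, s), r') :=
    fun _ _ _ _ _ _ => rfl
  let l : StrongDual ℝ (((P × Q) × ℝ) × (S × ℝ)) :=
    (ContinuousLinearMap.coprod (-(φ.coprod ψ)) (ContinuousLinearMap.id ℝ ℝ)).coprod
      (ContinuousLinearMap.coprod (-(ψ.comp D)) (ContinuousLinearMap.id ℝ ℝ))
  have hl : ∀ p q r s r', l (((p, q), r), (s, r')) = r + r' - φ p - ψ q - ψ (D s) := by
    intro p q r s r'
    simp [l]
    ring
  have hmem : ∀ v, v ∈ Prod.fst '' effDom g - A '' (Prod.fst '' effDom f) ↔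
      ∃ z, (z, v) ∈ Lf ⁻¹' epi f ∩ Lg ⁻¹' epi g := by
    intro v
    rw [mem_fst_effDom_sub]
    constructor
    · rintro ⟨p, q, s, h1, h2⟩
      obtain ⟨r, hr⟩ := hf.exists_eq_coe h1
      obtain ⟨r', hr'⟩ := hg.exists_eq_coe h2
      exact ⟨(((p, q), r), (s, r')), hr.le, hr'.le⟩
    · rintro ⟨⟨⟨⟨p, q⟩, r⟩, ⟨s, r'⟩⟩, h1, h2⟩
      exact ⟨p, q, s, lt_of_le_of_lt h1 (EReal.coe_lt_top r),
        lt_of_le_of_lt h2 (EReal.coe_lt_top r')⟩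
  obtain ⟨η, hη⟩ := exists_multiplier (K := Lf ⁻¹' epi f ∩ Lg ⁻¹' epi g)
    (((isClosed_epi hf.lsc).preimage Lf.continuous).inter
      ((isClosed_epi hg.lsc).preimage Lg.continuous))
    ((hf.convex.linear_preimage Lf.toLinearMap).inter (hg.convex.linear_preimage Lg.toLinearMap))
    H hH
    (fun z v h => by
      have : v ∈ coneUnion (Prod.fst '' effDom g - A '' (Prod.fst '' effDom f)) :=
        mem_coneUnion.2 ⟨1, one_pos, by rw [one_smul]; exact (hmem v).2 ⟨z, h⟩⟩
      rwa [hcone] at this)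
    (fun v hv => by
      have : v ∈ (H : Set R) := hv
      rw [← hcone, mem_coneUnion] at this
      obtain ⟨t, ht, h⟩ := this
      exact ⟨t, ht, (hmem _).1 h⟩)
    l (-c)
    (by
      rintro ⟨⟨⟨p, q⟩, r⟩, ⟨s, r'⟩⟩ ⟨h1, h2⟩
      rw [hl]
      rw [mem_preimage, hLf, mem_epi] at h1
      rw [mem_preimage, hLg, mem_epi, add_zero] at h2
      have h3 := conj_le_coe_iff.1 hc (p, q + D s)
      have h4 := EReal.coe_le_coe_iff.1 (h3.trans (marginalSum_le h1 h2))
      simp at h4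
      linarith)
  refine ⟨η, conj_add_conj_le hf.proper hg.proper ?_⟩
  rintro ⟨⟨p, q⟩, r⟩ h1 ⟨⟨w, s⟩, r'⟩ h2
  have := hη (((p, q), r), (s, r')) (w - A p) ⟨h1, by
    rw [mem_preimage, hLg, add_sub_cancel]; exact h2⟩
  rw [hl] at this
  simp [adj] at this ⊢
  linarith

theorem effDom_marginalSum_nonempty_of_zero_mem_coneUnion
    (h : (0 : R) ∈ coneUnion (Prod.fst '' effDom g - A '' (Prod.fst '' effDom f))) :
    (effDom (marginalSum f g A D)).Nonempty := by
  obtain ⟨t, -, ht⟩ := mem_coneUnion.1 h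
  rw [smul_zero, mem_fst_effDom_sub] at ht
  obtain ⟨p, q, s, h1, h2⟩ := ht
  rw [add_zero] at h2
  exact ⟨_, mem_effDom_marginalSum h1 h2⟩

theorem isLeast_conj_marginalSum [CompleteSpace P] [CompleteSpace Q] [CompleteSpace R]
    [CompleteSpace S] (hf : IsPCLSC f) (hg : IsPCLSC g) (H : Submodule ℝ R)
    (hH : IsClosed (H : Set R))
    (hcone : coneUnion (Prod.fst '' effDom g - A '' (Prod.fst '' effDom f)) = (H : Set R))
    (φ : StrongDual ℝ P) (ψ : StrongDual ℝ Q) :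
    IsLeast (range fun η : StrongDual ℝ R =>
        conj f ((φ - adj A η).coprod ψ) + conj g (η.coprod (adj D ψ)))
      (conj (marginalSum f g A D) (φ.coprod ψ)) := by
  refine ⟨?_, ?_⟩
  · have hb : conj (marginalSum f g A D) (φ.coprod ψ) ≠ ⊥ :=
      conj_ne_bot (effDom_marginalSum_nonempty_of_zero_mem_coneUnion (hcone ▸ H.zero_mem)) _
    by_cases ht : conj (marginalSum f g A D) (φ.coprod ψ) = ⊤
    -- By weak duality every candidate is `⊤`, so any `η` attains the minimum.
    · refine ⟨0, ?_⟩
      have := conj_marginalSum_le (A := A) (D := D) hf hg φ ψ 0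
      rw [ht, top_le_iff] at this
      rw [ht]
      exact this
    · have hc := EReal.coe_toReal ht hb
      obtain ⟨η, hη⟩ := exists_conj_add_conj_le hf hg H hH hcone φ ψ hc.ge
      rw [hc] at hη
      exact ⟨η, le_antisymm hη (conj_marginalSum_le hf hg φ ψ η)⟩
  · rintro _ ⟨η, rfl⟩
    exact conj_marginalSum_le hf hg φ ψ η

end MarginalSum

/-! ### Closing the epigraph -/

section ClosedHull

variable {E : Type*} [NormedAddCommGroup E] [NormedSpace ℝ E]

theorem closedHull_le {X : Type*} [TopologicalSpace X] (h : X → EReal) (x : X) :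
    closedHull h x ≤ h x := by
  refine EReal.le_of_forall_lt_iff_le.1 fun r hr => ?_
  exact sInf_le (mem_image_of_mem _ (subset_closure hr.le))

/-- The pairing is norm continuous, so its epigraph is closed and contains the closure of `epi h`;
passing to the smaller function `closedHull h` can only increase the conjugate. -/
theorem isStronglyRepresentative_closedHull {h : E × StrongDual ℝ E → EReal}
    (hc : Convex ℝ (epi h)) (hd : (effDom h).Nonempty)
    (hp : ∀ (x : E) (x' : StrongDual ℝ E), ((x' x : ℝ) : EReal) ≤ h (x, x'))
    (hconj : ∀ (x' : StrongDual ℝ E) (x'' : StrongDual ℝ (StrongDual ℝ E)),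
      ((x'' x' : ℝ) : EReal) ≤ conjProd h (x', x'')) :
    IsStronglyRepresentative (closedHull h) := by
  have hge : ∀ (x : E) (x' : StrongDual ℝ E), ((x' x : ℝ) : EReal) ≤ closedHull h (x, x') := by
    intro x x'
    have hsub : closure (epi h) ⊆ {p | p.1.2 p.1.1 ≤ p.2} := by
      refine closure_minimal ?_ (isClosed_le ?_ continuous_snd)
      · rintro ⟨⟨y, y'⟩, r⟩ hr
        exact EReal.coe_le_coe_iff.1 ((hp y y').trans hr)
      · exact (continuous_snd.comp continuous_fst).clm_apply (continuous_fst.comp continuous_fst)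
    refine le_sInf ?_
    rintro _ ⟨r, hr, rfl⟩
    exact EReal.coe_le_coe_iff.2 (hsub hr)
  have hbot : ∀ p, closedHull h p ≠ ⊥ := fun p hpb => by
    have := hge p.1 p.2
    rw [hpb, le_bot_iff] at this
    exact EReal.coe_ne_bot _ this
  exact
    { pclsc :=
        { ne_bot := hbot
          proper := hd.mono fun x hx => lt_of_le_of_lt (closedHull_le h x) hx
          convex := by rw [epi_closedHull]; exact hc.closure
          lsc := lowerSemicontinuous_of_isClosed_epi hbot
            (by rw [epi_closedHull]; exact isClosed_closure) }
      ge_pairing := hge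
      conj_ge_pairing := fun x' x'' => (hconj x' x'').trans (conj_anti (closedHull_le h) _) }

end ClosedHull

/-! ### The Brøndsted–Rockafellar property -/

section BrondstedRockafellar

variable {E : Type*} [NormedAddCommGroup E] [NormedSpace ℝ E]

theorem norm_combo_sq_le (u v : E) {a b : ℝ} (ha : 0 ≤ a) (hb : 0 ≤ b) (hab : a + b = 1) :
    ‖a • u + b • v‖ ^ 2 ≤ a * ‖u‖ ^ 2 + b * ‖v‖ ^ 2 := by
  have h1 : ‖a • u + b • v‖ ≤ a * ‖u‖ + b * ‖v‖ := by
    refine (norm_add_le _ _).trans_eq ?_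
    rw [norm_smul, norm_smul, Real.norm_of_nonneg ha, Real.norm_of_nonneg hb]
  have h2 : ‖a • u + b • v‖ ^ 2 ≤ (a * ‖u‖ + b * ‖v‖) ^ 2 := by gcongr
  obtain rfl : b = 1 - a := by linarith
  nlinarith [mul_nonneg (mul_nonneg ha hb) (sq_nonneg (‖u‖ - ‖v‖))]

/-- The conjugate of `m ‖·‖² / 2` is `m⁻¹ ‖·‖² / 2`. Along each line the hypothesis is a nonnegative
quadratic, and its discriminant bounds `φ v`. -/
theorem le_neg_norm_sq_of_forall_le (φ : StrongDual ℝ E) {m L : ℝ} (hm : 0 < m)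
    (h : ∀ v, L ≤ φ v + m * ‖v‖ ^ 2 / 2) : L ≤ -(m⁻¹ * ‖φ‖ ^ 2 / 2) := by
  have hL : L ≤ 0 := by simpa using h 0
  have hnn : 0 ≤ -2 * m * L := by nlinarith
  have hle : ‖φ‖ ≤ √(-2 * m * L) := by
    refine φ.opNorm_le_bound (Real.sqrt_nonneg _) fun v => ?_
    have hd : discrim (m * ‖v‖ ^ 2 / 2) (φ v) (-L) ≤ 0 := by
      refine discrim_le_zero fun t => ?_
      have := h (t • v)
      rw [map_smul, norm_smul, mul_pow, Real.norm_eq_abs, sq_abs, smul_eq_mul] at this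
      linarith
    rw [discrim] at hd
    refine abs_le_of_sq_le_sq ?_ (by positivity)
    rw [mul_pow, Real.sq_sqrt hnn]
    linarith
  have h2 : ‖φ‖ ^ 2 ≤ -2 * m * L := by
    rw [← Real.sq_sqrt hnn]
    gcongr
  have h3 : m⁻¹ * ‖φ‖ ^ 2 ≤ -2 * L := by
    rw [inv_mul_le_iff₀ hm]
    linarith
  linarith

variable {f : E × StrongDual ℝ E → EReal}

/-- The infimum of `f` regularized by the squared distance to a point, and tilted so that the
pairing becomes centred there, is at most `0`. -/
theorem IsStronglyRepresentative.exists_regularized_lt (hf : IsStronglyRepresentative f)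
    (x₀ : E) (x₀' : StrongDual ℝ E) {m η : ℝ} (hm : 0 < m) (hη : 0 < η) :
    ∃ (x : E) (x' : StrongDual ℝ E) (r : ℝ), f (x, x') ≤ r ∧
      r - x₀' x - x' x₀ + x₀' x₀ + (m * ‖x - x₀‖ ^ 2 + m⁻¹ * ‖x' - x₀'‖ ^ 2) / 2 < η := by
  by_contra! hcon
  -- Otherwise `f` dominates the continuous concave `k`, and Hahn–Banach inserts an affine function
  -- `y' x + y'' x' + c` between them.
  set k : E × StrongDual ℝ E → ℝ := fun p => η + x₀' p.1 + p.2 x₀ - x₀' x₀ -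
    (m * ‖p.1 - x₀‖ ^ 2 + m⁻¹ * ‖p.2 - x₀'‖ ^ 2) / 2 with hk
  have hkcont : Continuous k := by
    have : Continuous fun p : E × StrongDual ℝ E => p.2 x₀ :=
      continuous_snd.clm_apply continuous_const
    fun_prop
  have hconv : Convex ℝ {p : (E × StrongDual ℝ E) × ℝ | p.2 < k p.1} := by
    refine convex_iff_forall_pos.2 ?_
    rintro ⟨⟨x, x'⟩, r⟩ hr ⟨⟨y, y'⟩, s⟩ hs a b ha hb hab
    simp only [hk, mem_ofPred_eq] at hr hs
    have h1 := norm_combo_sq_le (x - x₀) (y - x₀) ha.le hb.le hab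
    have h2 := norm_combo_sq_le (x' - x₀') (y' - x₀') ha.le hb.le hab
    have e1 : a • (x - x₀) + b • (y - x₀) = a • x + b • y - x₀ := by
      rw [smul_sub, smul_sub, sub_add_sub_comm, ← add_smul, hab, one_smul]
    have e2 : a • (x' - x₀') + b • (y' - x₀') = a • x' + b • y' - x₀' := by
      rw [smul_sub, smul_sub, sub_add_sub_comm, ← add_smul, hab, one_smul]
    rw [e1] at h1
    rw [e2] at h2
    have h1' := mul_le_mul_of_nonneg_left h1 hm.le
    have h2' := mul_le_mul_of_nonneg_left h2 (inv_pos.2 hm).le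
    have hr' := mul_lt_mul_of_pos_left hr ha
    have hs' := mul_lt_mul_of_pos_left hs hb
    obtain rfl : b = 1 - a := by linarith
    simp only [hk, mem_ofPred_eq, Prod.smul_mk, Prod.mk_add_mk, smul_eq_mul, map_add, map_smul,
      _root_.add_apply, _root_.smul_apply]
    linarith
  have hdisj : Disjoint {p : (E × StrongDual ℝ E) × ℝ | p.2 < k p.1} (epi f) := by
    rw [Set.disjoint_left]
    rintro ⟨⟨x, x'⟩, r⟩ hr hp
    have := hcon x x' r hp
    simp only [hk, mem_ofPred_eq] at hr
    linarith
  obtain ⟨Λ, u, hΛ1, hΛ2⟩ := geometric_hahn_banach_open hconv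
    (isOpen_lt continuous_snd (hkcont.comp continuous_fst)) hf.pclsc.convex hdisj
  set s := Λ (0, 1) with hs
  set α : StrongDual ℝ E := Λ.comp ((ContinuousLinearMap.inl ℝ _ ℝ).comp
    (ContinuousLinearMap.inl ℝ E (StrongDual ℝ E))) with hα
  set β : StrongDual ℝ (StrongDual ℝ E) := Λ.comp ((ContinuousLinearMap.inl ℝ _ ℝ).comp
    (ContinuousLinearMap.inr ℝ E (StrongDual ℝ E))) with hβ
  have hdec : ∀ x x' r, Λ ((x, x'), r) = α x + β x' + r * s := by
    intro x x' r
    have : ((x, x'), r) = ((x, (0 : StrongDual ℝ E)), (0 : ℝ)) + (((0 : E), x'), (0 : ℝ)) +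
        r • ((0 : E × StrongDual ℝ E), (1 : ℝ)) := by simp
    rw [this, map_add, map_add, map_smul]
    rfl
  have hs0 : 0 < s := by
    obtain ⟨⟨x, x'⟩, hx⟩ := hf.pclsc.proper
    obtain ⟨r, hr⟩ := hf.pclsc.exists_eq_coe hx
    have h1 := hΛ2 ((x, x'), r) hr.le
    have h2 := hΛ1 ((x, x'), k (x, x') - 1) (by simp)
    have h3 := hcon x x' r hr.le
    rw [hdec] at h1 h2
    have h4 : 0 < (r - (k (x, x') - 1)) * s := by linarith
    have h5 : k (x, x') ≤ r := by
      simp only [hk]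
      linarith
    exact pos_of_mul_pos_right h4 (by linarith)
  set y' : StrongDual ℝ E := -s⁻¹ • α with hy'
  set y'' : StrongDual ℝ (StrongDual ℝ E) := -s⁻¹ • β with hy''
  have hα' : ∀ x, α x = -(s * y' x) := by
    intro x
    simp only [hy', _root_.smul_apply, smul_eq_mul]
    field_simp
  have hβ' : ∀ x, β x = -(s * y'' x) := by
    intro x
    simp only [hy'', _root_.smul_apply, smul_eq_mul]
    field_simp
  set c := u / s with hc
  have hu : u = s * c := by rw [hc]; field_simp
  -- The affine minorant bounds the conjugate at `(y', y'')`; this is where the hypothesis on the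
  -- conjugate enters.
  have hepi : y'' y' ≤ -c := by
    have : conjProd f (y', y'') ≤ ((-c : ℝ) : EReal) := by
      refine conj_le_coe_iff_epi.2 ?_
      rintro ⟨⟨x, x'⟩, r⟩ hr
      have h1 := hΛ2 _ hr
      rw [hdec, hα', hβ', hu] at h1
      have h2 : s * c ≤ s * (r - y' x - y'' x') := by linarith
      have h3 := le_of_mul_le_mul_left h2 hs0
      simp only [ContinuousLinearMap.coprod_apply]
      linarith
    exact EReal.coe_le_coe_iff.1 ((hf.conj_ge_pairing y' y'').trans this)
  have hhyp : ∀ x x', k (x, x') ≤ y' x + y'' x' + c := by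
    intro x x'
    refine le_of_forall_lt fun r hr => ?_
    have h1 := hΛ1 ((x, x'), r) hr
    rw [hdec, hα', hβ', hu] at h1
    have h2 : s * r < s * (y' x + y'' x' + c) := by linarith
    exact lt_of_mul_lt_mul_left h2 hs0.le
  -- Taking the second coordinate equal to `y'` turns the bidual term into `y'' y'`; with `hepi`
  -- this forces `η ≤ 0`.
  have hkey := le_neg_norm_sq_of_forall_le (y' - x₀') hm
    (L := η - c - y'' y' - m⁻¹ * ‖y' - x₀'‖ ^ 2 / 2) (fun v => by
      have h1 := hhyp (x₀ + v) (x₀' + (y' - x₀'))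
      simp only [hk, add_sub_cancel_left, map_add, map_sub, _root_.add_apply,
        _root_.sub_apply] at h1 ⊢
      linarith)
  linarith

/-- The tilted quantity equals the gap `r - x' x` plus `(x' - x₀') (x - x₀)`, and half the weighted
squared distance `N` absorbs the latter, so the new gap is small. That the midpoint also has
nonnegative gap bounds the same product from below, which in turn bounds `N`. -/
theorem IsStronglyRepresentative.exists_epi_half (hf : IsStronglyRepresentative f)
    {x₀ : E} {x₀' : StrongDual ℝ E} {r₀ s μ : ℝ} (hs : 0 < s) (hμ : 0 < μ)
    (h₀ : f (x₀, x₀') ≤ r₀) (hr₀ : r₀ - x₀' x₀ ≤ s ^ 2) :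
    ∃ (x : E) (x' : StrongDual ℝ E) (r : ℝ), f (x, x') ≤ r ∧ r - x' x ≤ (s * 2⁻¹) ^ 2 ∧
      ‖x - x₀‖ ≤ 3 * s / μ ∧ ‖x' - x₀'‖ ≤ 3 * s * μ := by
  obtain ⟨x, x', r, hr, hlt⟩ := hf.exists_regularized_lt x₀ x₀' (m := μ ^ 2)
    (η := (s * 2⁻¹) ^ 2) (by positivity) (by positivity)
  set N := μ ^ 2 * ‖x - x₀‖ ^ 2 + (μ ^ 2)⁻¹ * ‖x' - x₀'‖ ^ 2 with hN
  have hq : (x' - x₀') (x - x₀) = x' x - x' x₀ - x₀' x + x₀' x₀ := by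
    simp only [map_sub, _root_.sub_apply]
    ring
  have hqN : -(N / 2) ≤ (x' - x₀') (x - x₀) := by
    have h1 := (x' - x₀').le_opNorm (x - x₀)
    rw [Real.norm_eq_abs] at h1
    have h2 := (abs_le.1 h1).1
    have h3 : 0 ≤ (μ * ‖x - x₀‖ - μ⁻¹ * ‖x' - x₀'‖) ^ 2 := sq_nonneg _
    have h4 : (μ * ‖x - x₀‖ - μ⁻¹ * ‖x' - x₀'‖) ^ 2
        = N - 2 * (‖x' - x₀'‖ * ‖x - x₀‖) := by
      rw [hN]
      field_simp
      ring
    linarith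
  have hmid : 0 ≤ (r - x' x) / 2 + (r₀ - x₀' x₀) / 2 + (x' - x₀') (x - x₀) / 4 := by
    have h1 := hf.pclsc.convex (x := ((x, x'), r)) (y := ((x₀, x₀'), r₀)) hr h₀
      (by norm_num : (0 : ℝ) ≤ 2⁻¹) (by norm_num : (0 : ℝ) ≤ 2⁻¹) (by norm_num)
    simp only [Prod.smul_mk, Prod.mk_add_mk, mem_epi, smul_eq_mul] at h1
    have h2 := EReal.coe_le_coe_iff.1 ((hf.ge_pairing _ _).trans h1)
    simp only [map_add, map_smul, _root_.add_apply, _root_.smul_apply,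
      smul_eq_mul] at h2
    rw [hq]
    linarith
  -- The estimates give `N < 5 * s ^ 2`; `9` is used for its square root.
  have hN9 : N ≤ (3 * s) ^ 2 := by nlinarith
  refine ⟨x, x', r, hr, by linarith, ?_, ?_⟩
  · rw [le_div_iff₀ hμ]
    refine le_of_sq_le_sq ?_ (by positivity)
    have : 0 ≤ (μ ^ 2)⁻¹ * ‖x' - x₀'‖ ^ 2 := by positivity
    calc (‖x - x₀‖ * μ) ^ 2 = μ ^ 2 * ‖x - x₀‖ ^ 2 := by ring
      _ ≤ N := by linarith
      _ ≤ _ := hN9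
  · rw [← div_le_iff₀ hμ]
    refine le_of_sq_le_sq ?_ (by positivity)
    have : 0 ≤ μ ^ 2 * ‖x - x₀‖ ^ 2 := by positivity
    calc (‖x' - x₀'‖ / μ) ^ 2 = (μ ^ 2)⁻¹ * ‖x' - x₀'‖ ^ 2 := by ring
      _ ≤ N := by linarith
      _ ≤ _ := hN9

/-- A Brøndsted–Rockafellar property of strongly representative functions. -/
theorem IsStronglyRepresentative.exists_mem_multi [CompleteSpace E]
    (hf : IsStronglyRepresentative f) {x₀ : E} {x₀' : StrongDual ℝ E} {r₀ s μ : ℝ} (hs : 0 < s)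
    (hμ : 0 < μ) (h₀ : f (x₀, x₀') ≤ r₀) (hr₀ : r₀ - x₀' x₀ ≤ s ^ 2) :
    ∃ (z : E) (z' : StrongDual ℝ E), (z, z') ∈ multi f ∧
      dist x₀ z ≤ 6 * s / μ ∧ dist x₀' z' ≤ 6 * s * μ := by
  -- The gap bound is quartered at each step, so step lengths halve and total at most `6 * s / μ`
  -- and `6 * s * μ`.
  let T : ℕ → Type _ := fun n =>
    {p : (E × StrongDual ℝ E) × ℝ // p ∈ epi f ∧ p.2 - p.1.2 p.1.1 ≤ (s * 2⁻¹ ^ n) ^ 2}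
  have hnext : ∀ n (p : T n), ∃ p' : T (n + 1), ‖p'.1.1.1 - p.1.1.1‖ ≤ 3 * (s * 2⁻¹ ^ n) / μ ∧
      ‖p'.1.1.2 - p.1.1.2‖ ≤ 3 * (s * 2⁻¹ ^ n) * μ := by
    rintro n ⟨⟨⟨x, x'⟩, r⟩, hr, hle⟩
    obtain ⟨y, y', t, h1, h2, h3, h4⟩ := hf.exists_epi_half (by positivity) hμ hr hle
    exact ⟨⟨((y, y'), t), h1, by rwa [pow_succ 2⁻¹ n, ← mul_assoc]⟩, h3, h4⟩
  choose next hn1 hn2 using hnext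
  let w : ∀ n, T n := fun n => Nat.rec (motive := T) ⟨((x₀, x₀'), r₀), h₀, by simpa using hr₀⟩ next n
  have hd1 : ∀ n, dist (w n).1.1.1 (w (n + 1)).1.1.1 ≤ 3 * s / μ * 2⁻¹ ^ n := fun n => by
    rw [dist_comm, dist_eq_norm]
    exact (hn1 n (w n)).trans_eq (by ring)
  have hd2 : ∀ n, dist (w n).1.1.2 (w (n + 1)).1.1.2 ≤ 3 * s * μ * 2⁻¹ ^ n := fun n => by
    rw [dist_comm, dist_eq_norm]
    exact (hn2 n (w n)).trans_eq (by ring)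
  obtain ⟨z, hz⟩ := cauchySeq_tendsto_of_complete (cauchySeq_of_le_geometric _ _ (by norm_num) hd1)
  obtain ⟨z', hz'⟩ := cauchySeq_tendsto_of_complete
    (cauchySeq_of_le_geometric _ _ (by norm_num) hd2)
  have hb1 := dist_le_of_le_geometric_of_tendsto₀ _ _ (by norm_num) hd1 hz
  have hb2 := dist_le_of_le_geometric_of_tendsto₀ _ _ (by norm_num) hd2 hz'
  refine ⟨z, z', ?_, hb1.trans_eq (by ring), hb2.trans_eq (by ring)⟩
  have hmem : ∀ n, (((w n).1.1.1, (w n).1.1.2), (w n).1.1.2 (w n).1.1.1 + (s * 2⁻¹ ^ n) ^ 2)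
      ∈ epi f := fun n =>
    (mem_epi.1 (w n).2.1).trans (EReal.coe_le_coe_iff.2 (by linarith [(w n).2.2]))
  have hpow : Tendsto (fun n : ℕ => (s * (2⁻¹ : ℝ) ^ n) ^ 2) atTop (𝓝 0) := by
    have := ((tendsto_pow_atTop_nhds_zero_of_lt_one (r := (2⁻¹ : ℝ)) (by norm_num)
      (by norm_num)).const_mul s).pow 2
    simpa using this
  have hpair : Continuous fun p : E × StrongDual ℝ E => p.2 p.1 :=
    continuous_snd.clm_apply continuous_fst
  have hlim := (hz.prodMk_nhds hz').prodMk_nhds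
    (((hpair.tendsto (z, z')).comp (hz.prodMk_nhds hz')).add hpow)
  rw [add_zero] at hlim
  have hle := (isClosed_epi hf.pclsc.lsc).mem_of_tendsto hlim (Eventually.of_forall hmem)
  exact le_antisymm hle (hf.ge_pairing z z')

/-- `C` does not depend on `μ`: large `μ` gives density of the domain, small `μ` that of the range.
-/
theorem IsStronglyRepresentative.exists_forall_mem_multi [CompleteSpace E]
    (hf : IsStronglyRepresentative f) {p : E × StrongDual ℝ E} (hp : p ∈ effDom f) :
    ∃ C : ℝ, 0 < C ∧ ∀ μ > 0, ∃ q ∈ multi f, dist p.1 q.1 ≤ C / μ ∧ dist p.2 q.2 ≤ C * μ := by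
  obtain ⟨r, hr⟩ := hf.pclsc.exists_eq_coe hp
  -- Adding `1` makes `s ≥ 1`, hence `s ^ 2` dominates the gap.
  set s := |r - p.2 p.1| + 1 with hs
  have hs0 : 0 < s := by positivity
  refine ⟨6 * s, by positivity, fun μ hμ => ?_⟩
  obtain ⟨z, z', h1, h2, h3⟩ := hf.exists_mem_multi (x₀ := p.1) (x₀' := p.2) hs0 hμ hr.le
    (by nlinarith [le_abs_self (r - p.2 p.1), abs_nonneg (r - p.2 p.1)])
  exact ⟨(z, z'), h1, h2, h3⟩

theorem IsStronglyRepresentative.fst_effDom_subset [CompleteSpace E]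
    (hf : IsStronglyRepresentative f) : Prod.fst '' effDom f ⊆ closure (multi f).dom := by
  rintro _ ⟨p, hp, rfl⟩
  obtain ⟨C, hC, h⟩ := hf.exists_forall_mem_multi hp
  refine Metric.mem_closure_iff.2 fun ε hε => ?_
  obtain ⟨q, hq, h1, -⟩ := h (2 * C / ε) (by positivity)
  refine ⟨q.1, ⟨q.2, hq⟩, h1.trans_lt ?_⟩
  rw [show C / (2 * C / ε) = ε / 2 by field_simp]
  linarith

theorem IsStronglyRepresentative.snd_effDom_subset [CompleteSpace E]
    (hf : IsStronglyRepresentative f) : Prod.snd '' effDom f ⊆ closure (multi f).cod := by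
  rintro _ ⟨p, hp, rfl⟩
  obtain ⟨C, hC, h⟩ := hf.exists_forall_mem_multi hp
  refine Metric.mem_closure_iff.2 fun ε hε => ?_
  obtain ⟨q, hq, -, h2⟩ := h (ε / (2 * C)) (by positivity)
  refine ⟨q.2, ⟨q.1, hq⟩, h2.trans_lt ?_⟩
  rw [show C * (ε / (2 * C)) = ε / 2 by field_simp]
  linarith

/-- By continuity of subtraction and `L`, the closed `H` also contains `S₁ - L '' S₂`, and then its
positive multiples. -/
theorem coneUnion_eq_of_subset_closure {V W : Type*} [NormedAddCommGroup V] [NormedSpace ℝ V]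
    [NormedAddCommGroup W] [NormedSpace ℝ W] (L : W →L[ℝ] V) {M₁ S₁ : Set V} {M₂ S₂ : Set W}
    (h₁ : S₁ ⊆ closure M₁) (h₂ : S₂ ⊆ closure M₂) {H : Submodule ℝ V}
    (hH : IsClosed (H : Set V)) (hM : M₁ - L '' M₂ ⊆ (H : Set V))
    (hS : (H : Set V) ⊆ coneUnion (S₁ - L '' S₂)) : coneUnion (S₁ - L '' S₂) = (H : Set V) := by
  refine subset_antisymm (fun v hv => ?_) hS
  obtain ⟨t, ht, htv⟩ := mem_coneUnion.1 hv
  obtain ⟨x, hx, _, ⟨y, hy, rfl⟩, hxy⟩ := Set.mem_sub.1 htv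
  have hmaps : MapsTo (fun p : V × W => p.1 - L p.2) (M₁ ×ˢ M₂) (H : Set V) := fun p hp =>
    hM (Set.sub_mem_sub hp.1 (mem_image_of_mem _ hp.2))
  have hc : Continuous fun p : V × W => p.1 - L p.2 := by fun_prop
  have hmem : (x, y) ∈ closure (M₁ ×ˢ M₂) := by
    rw [closure_prod_eq]
    exact ⟨h₁ hx, h₂ hy⟩
  have h3 := hmaps.closure hc hmem
  rw [hH.closure_eq] at h3
  dsimp only at h3
  rw [hxy] at h3
  exact (H.smul_mem_iff ht.ne').1 h3

end BrondstedRockafellar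

/-! ### Conjugates and strong representativity of the two operations -/

theorem fst_image_effDom_comp_swap {X Y : Type*} (k : X × Y → EReal) :
    Prod.fst '' effDom (k ∘ Prod.swap) = Prod.snd '' effDom k := by
  ext y
  constructor
  · rintro ⟨p, hp, rfl⟩
    exact ⟨p.swap, hp, rfl⟩
  · rintro ⟨p, hp, rfl⟩
    exact ⟨p.swap, by simpa [effDom] using hp, rfl⟩

section StrongRepresentability

variable {E F : Type*} [NormedAddCommGroup E] [NormedSpace ℝ E] [CompleteSpace E]
  [NormedAddCommGroup F] [NormedSpace ℝ F] [CompleteSpace F]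
  {f : E × StrongDual ℝ E → EReal} {g : F × StrongDual ℝ F → EReal}

theorem isLeast_conjProd_infSum (hf : IsPCLSC f) (hg : IsPCLSC g) (A : E →L[ℝ] F)
    (H : Submodule ℝ F) (hH : IsClosed (H : Set F))
    (hcone : coneUnion (Prod.fst '' effDom g - A '' (Prod.fst '' effDom f)) = (H : Set F))
    (x' : StrongDual ℝ E) (x'' : StrongDual ℝ (StrongDual ℝ E)) :
    IsLeast (range fun y' : StrongDual ℝ F =>
        conjProd f (x' - adj A y', x'') + conjProd g (y', adj (adj A) x''))
      (conjProd (infSum f g A) (x', x'')) :=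
  isLeast_conj_marginalSum hf hg H hH hcone x' x''

/-- After swapping coordinates in `f`, `g` and the result, this is a `marginalSum` over `adj B` and
`B`. -/
theorem isLeast_conjProd_infParallel (hf : IsPCLSC f) (hg : IsPCLSC g) (B : F →L[ℝ] E)
    (H : Submodule ℝ (StrongDual ℝ F)) (hH : IsClosed (H : Set (StrongDual ℝ F)))
    (hcone : coneUnion (Prod.snd '' effDom g - adj B '' (Prod.snd '' effDom f)) =
      (H : Set (StrongDual ℝ F)))
    (x' : StrongDual ℝ E) (x'' : StrongDual ℝ (StrongDual ℝ E)) :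
    IsLeast (range fun y'' : StrongDual ℝ (StrongDual ℝ F) =>
        conjProd f (x', x'' - adj (adj B) y'') + conjProd g (adj B x', y''))
      (conjProd (infParallel f g B) (x', x'')) := by
  have h := isLeast_conj_marginalSum (A := adj B) (D := B) hf.comp_swap hg.comp_swap H hH
    (by rw [fst_image_effDom_comp_swap, fst_image_effDom_comp_swap]; exact hcone) x'' x'
  simp only [conj_comp_swap] at h
  rw [← conj_comp_swap] at h
  exact h

theorem isStronglyRepresentative_closedHull_infSum (hf : IsStronglyRepresentative f)
    (hg : IsStronglyRepresentative g) (A : E →L[ℝ] F) (H : Submodule ℝ F)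
    (hH : IsClosed (H : Set F))
    (hcone : coneUnion (Prod.fst '' effDom g - A '' (Prod.fst '' effDom f)) = (H : Set F)) :
    IsStronglyRepresentative (closedHull (infSum f g A)) := by
  refine isStronglyRepresentative_closedHull
    (convex_epi_marginalSum hf.pclsc.ne_bot hg.pclsc.ne_bot hf.pclsc.convex hg.pclsc.convex)
    (effDom_marginalSum_nonempty_of_zero_mem_coneUnion (hcone ▸ H.zero_mem)) ?_ ?_
  · intro x x'
    refine le_iInf fun y' => ?_
    refine le_trans (le_of_eq ?_) (add_le_add (hf.ge_pairing x (x' - adj A y'))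
      (hg.ge_pairing (A x) y'))
    rw [← EReal.coe_add, EReal.coe_eq_coe_iff]
    simp [adj]
  · intro x' x''
    -- At a minimizer the conjugate is a sum of two terms, and their lower bounds add up to `x''
    -- x'`.
    obtain ⟨y', hy'⟩ := (isLeast_conjProd_infSum hf.pclsc hg.pclsc A H hH hcone x' x'').1
    rw [← hy']
    refine le_trans (le_of_eq ?_) (add_le_add (hf.conj_ge_pairing (x' - adj A y') x'')
      (hg.conj_ge_pairing y' (adj (adj A) x'')))
    rw [← EReal.coe_add, EReal.coe_eq_coe_iff]
    simp [adj]

theorem isStronglyRepresentative_closedHull_infParallel (hf : IsStronglyRepresentative f)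
    (hg : IsStronglyRepresentative g) (B : F →L[ℝ] E) (H : Submodule ℝ (StrongDual ℝ F))
    (hH : IsClosed (H : Set (StrongDual ℝ F)))
    (hcone : coneUnion (Prod.snd '' effDom g - adj B '' (Prod.snd '' effDom f)) =
      (H : Set (StrongDual ℝ F))) :
    IsStronglyRepresentative (closedHull (infParallel f g B)) := by
  refine isStronglyRepresentative_closedHull ?_ ?_ ?_ ?_
  · have h := convex_epi_marginalSum (A := adj B) (D := B) hf.pclsc.comp_swap.ne_bot
      hg.pclsc.comp_swap.ne_bot hf.pclsc.comp_swap.convex hg.pclsc.comp_swap.convex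
    rintro ⟨p, r⟩ hp ⟨q, s⟩ hq a b ha hb hab
    exact h (x := (p.swap, r)) (y := (q.swap, s)) hp hq ha hb hab
  · have h0 : (0 : StrongDual ℝ F) ∈ coneUnion (Prod.fst '' effDom (g ∘ Prod.swap) -
        adj B '' (Prod.fst '' effDom (f ∘ Prod.swap))) := by
      rw [fst_image_effDom_comp_swap, fst_image_effDom_comp_swap, hcone]
      exact H.zero_mem
    obtain ⟨p, hp⟩ := effDom_marginalSum_nonempty_of_zero_mem_coneUnion (D := B) h0
    exact ⟨p.swap, hp⟩
  · intro x x'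
    refine le_iInf fun y => ?_
    refine le_trans (le_of_eq ?_) (add_le_add (hf.ge_pairing (x - B y) x')
      (hg.ge_pairing y (adj B x')))
    rw [← EReal.coe_add, EReal.coe_eq_coe_iff]
    simp [adj]
  · intro x' x''
    obtain ⟨y'', hy''⟩ := (isLeast_conjProd_infParallel hf.pclsc hg.pclsc B H hH hcone x' x'').1
    rw [← hy'']
    refine le_trans (le_of_eq ?_) (add_le_add (hf.conj_ge_pairing x' (x'' - adj (adj B) y''))
      (hg.conj_ge_pairing (adj B x') y''))
    rw [← EReal.coe_add, EReal.coe_eq_coe_iff]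
    simp [adj]

end StrongRepresentability

end Sandwich

theorem theorem20 {E F : Type*}
    [NormedAddCommGroup E] [NormedSpace ℝ E] [CompleteSpace E] [Nontrivial E]
    [NormedAddCommGroup F] [NormedSpace ℝ F] [CompleteSpace F] [Nontrivial F]
    (f : E × StrongDual ℝ E → EReal) (hf : Sandwich.IsStronglyRepresentative f)
    (g : F × StrongDual ℝ F → EReal) (hg : Sandwich.IsStronglyRepresentative g) :
    (∀ (A : E →L[ℝ] F) (H : Submodule ℝ F), IsClosed (H : Set F) →
      (Sandwich.multi g).dom - A '' (Sandwich.multi f).dom ⊆ (H : Set F) →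
      (H : Set F) ⊆ Sandwich.coneUnion
        (Prod.fst '' Sandwich.effDom g - A '' (Prod.fst '' Sandwich.effDom f)) →
      Sandwich.coneUnion
        (Prod.fst '' Sandwich.effDom g - A '' (Prod.fst '' Sandwich.effDom f)) = (H : Set F) ∧
      (∀ (x' : StrongDual ℝ E) (x'' : StrongDual ℝ (StrongDual ℝ E)),
        IsLeast
          (range fun y' : StrongDual ℝ F =>
            Sandwich.conjProd f (x' - Sandwich.adj A y', x'') +
              Sandwich.conjProd g (y', Sandwich.adj (Sandwich.adj A) x''))
          (Sandwich.conjProd (Sandwich.infSum f g A) (x', x''))) ∧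
      Sandwich.IsStronglyRepresentative (Sandwich.closedHull (Sandwich.infSum f g A))) ∧
    (∀ (B : F →L[ℝ] E) (H : Submodule ℝ (StrongDual ℝ F)), IsClosed (H : Set (StrongDual ℝ F)) →
      (Sandwich.multi g).cod - Sandwich.adj B '' (Sandwich.multi f).cod ⊆
        (H : Set (StrongDual ℝ F)) →
      (H : Set (StrongDual ℝ F)) ⊆ Sandwich.coneUnion
        (Prod.snd '' Sandwich.effDom g -
          Sandwich.adj B '' (Prod.snd '' Sandwich.effDom f)) →
      Sandwich.coneUnion
        (Prod.snd '' Sandwich.effDom g -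
          Sandwich.adj B '' (Prod.snd '' Sandwich.effDom f)) = (H : Set (StrongDual ℝ F)) ∧
      (∀ (x' : StrongDual ℝ E) (x'' : StrongDual ℝ (StrongDual ℝ E)),
        IsLeast
          (range fun y'' : StrongDual ℝ (StrongDual ℝ F) =>
            Sandwich.conjProd f (x', x'' - Sandwich.adj (Sandwich.adj B) y'') +
              Sandwich.conjProd g (Sandwich.adj B x', y''))
          (Sandwich.conjProd (Sandwich.infParallel f g B) (x', x''))) ∧
      Sandwich.IsStronglyRepresentative (Sandwich.closedHull (Sandwich.infParallel f g B))) := by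
  refine ⟨fun A H hH hM hS => ?_, fun B H hH hM hS => ?_⟩
  · have hcone := Sandwich.coneUnion_eq_of_subset_closure A hg.fst_effDom_subset
      hf.fst_effDom_subset hH hM hS
    exact ⟨hcone, Sandwich.isLeast_conjProd_infSum hf.pclsc hg.pclsc A H hH hcone,
      Sandwich.isStronglyRepresentative_closedHull_infSum hf hg A H hH hcone⟩
  · have hcone := Sandwich.coneUnion_eq_of_subset_closure (Sandwich.adj B) hg.snd_effDom_subset
      hf.snd_effDom_subset hH hM hS
    exact ⟨hcone, Sandwich.isLeast_conjProd_infParallel hf.pclsc hg.pclsc B H hH hcone,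
      Sandwich.isStronglyRepresentative_closedHull_infParallel hf hg B H hH hcone⟩
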